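/- **Conventions.** Let $P$ be a poset. A map $f$ between posets is a *nonstrict homomorphism* ($\overline{\mathrm H}$) if $x\le y$ implies $f(x)\le f(y)$, and a *homomorphism* ($\mathrm H$) if $x<y$ implies $f(x)<f(y)$. A *monomorphism* ($\mathrm M$) is an injective homomorphism, and an *embedding* ($\mathrm I$) is an injective map with $x<y\iff f(x)<f(y)$. A (*nonstrict*) *epimorphism* ($\mathrm E$, respectively $\overline{\mathrm E}$) of $P$ is a surjective (nonstrict) homomorphism $P\to P$, and a *bimorphism* ($\mathrm B$) of $P$ is a bijective homomorphism $P\to P$. For $\mathrm X\in\{\mathrm I,\mathrm M,\mathrm H,\overline{\mathrm H}\}$ and $\mathrm Y\in\{\mathrm H,\overline{\mathrm H},\mathrm E,\overline{\mathrm E},\mathrm B\}$, the poset $P$ is $\mathrm{XY}$ if every map of kind $\mathrm X$ from a finite subset of $P$ (with the induced order) into $P$ extends to a map $P\to P$ of kind $\mathrm Y$. Let $V$ be the poset consisting of one point below two incomparable points, $\Lambda$ the poset consisting of one point above two incomparable points, and $Z$ the poset consisting of a two-element chain and a third point incomparable to both of its elements. **Theorem.** Let $P$ be a countable $\mathrm{I\overline{E}}$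 poset which embeds each of $V$, $\Lambda$ and $Z$ (as induced subposets). 1. If $P$ is $\mathrm{I\overline{H}}$, then $P$ is $\mathrm{\overline{H}\,\overline{E}}$. 2. If $P$ is $\mathrm{IH}$, then $P$ is both $\mathrm{HE}$ and $\mathrm{MB}$. (Every $\mathrm{I\overline{E}}$ poset is $\mathrm{I\overline{H}}$, so the hypothesis of 1 holds automatically.) -/

import Mathlib

namespace PosetHomog

/-! ### Kinds of maps between posets -/

section Maps

variable {α β : Type*} [PartialOrder α] [PartialOrder β]

/-- Nonstrict homomorphism: `x ≤ y` implies `f x ≤ f y`. -/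
def IsWeakHom (f : α → β) : Prop := ∀ x y, x ≤ y → f x ≤ f y

/-- (Strict) homomorphism: `x < y` implies `f x < f y`. -/
def IsHom (f : α → β) : Prop := ∀ x y, x < y → f x < f y

/-- Monomorphism: an injective homomorphism. (For injective maps, preserving `<` and
preserving `≤` are the same.) -/
def IsMono (f : α → β) : Prop := IsHom f ∧ Function.Injective f

/-- Embedding: an injective map preserving the order relation and its negation, that is, an
isomorphism onto its range. -/
def IsEmb (f : α → β) : Prop := Function.Injective f ∧ ∀ x y, x < y ↔ f x < f y

/-- Nonstrict epimorphism: a surjective nonstrict homomorphism. -/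
def IsWeakEpi (f : α → β) : Prop := IsWeakHom f ∧ Function.Surjective f

/-- (Strict) epimorphism: a surjective homomorphism. -/
def IsEpi (f : α → β) : Prop := IsHom f ∧ Function.Surjective f

/-- Bimorphism: a homomorphism that is both injective and surjective. -/
def IsBi (f : α → β) : Prop := IsMono f ∧ Function.Surjective f

end Maps

/-! ### Homomorphism-homogeneity -/

section Homogeneity

variable (P : Type*) [PartialOrder P]

/-- Every finite partial map of `P` into `P` (a map on a finite subset, with the induced order)
satisfying `X` extends to a totally defined map `P → P` satisfying `Y`. -/
def ExtendsTo (X : ∀ A : Finset P, (A → P) → Prop) (Y : (P → P) → Prop) : Prop :=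
  ∀ (A : Finset P) (f : A → P), X A f → ∃ g : P → P, Y g ∧ ∀ a : A, g a = f a

/-- Finite partial embeddings extend to nonstrict endomorphisms. -/
def IsIHbar : Prop := ExtendsTo P (fun _ f => IsEmb f) (fun g => IsWeakHom g)

/-- Finite partial embeddings extend to (strict) endomorphisms. -/
def IsIH : Prop := ExtendsTo P (fun _ f => IsEmb f) (fun g => IsHom g)

/-- Finite partial embeddings extend to nonstrict epimorphisms. -/
def IsIEbar : Prop := ExtendsTo P (fun _ f => IsEmb f) (fun g => IsWeakEpi g)

/-- Finite partial nonstrict endomorphisms extend to nonstrict epimorphisms. -/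
def IsHbarEbar : Prop := ExtendsTo P (fun _ f => IsWeakHom f) (fun g => IsWeakEpi g)

/-- Finite partial (strict) endomorphisms extend to (strict) epimorphisms. -/
def IsHE : Prop := ExtendsTo P (fun _ f => IsHom f) (fun g => IsEpi g)

/-- Finite partial monomorphisms extend to bimorphisms. -/
def IsMB : Prop := ExtendsTo P (fun _ f => IsMono f) (fun g => IsBi g)

end Homogeneity

/-! ### The three-element posets V, Λ and Z

`Unit ⊕ Unit` carries the disjoint sum order, so it is the two-element antichain. -/

/-- V: one point below two incomparable points. -/
abbrev PosetV : Type := WithBot (Unit ⊕ Unit)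

/-- Λ: one point above two incomparable points. -/
abbrev PosetLambda : Type := WithTop (Unit ⊕ Unit)

/-- Z: a two-element chain together with a point incomparable to both of its elements. -/
abbrev PosetZ : Type := Fin 2 ⊕ Unit

end PosetHomog

/-!
The extension `P → P` is built by back-and-forth, so finite partial maps of each kind must extend by
one more argument and by one more value.

*Values.* Since `V` and `Λ` embed, extending a bijection between two-element antichains shows that
every pair of elements has a lower and an upper bound, so every finite set lies in an interval
`[l, u]` with `l < u`. A nonstrict epimorphism sending `l < u` onto the chain of a copy of `Z` must
send some element to the isolated point of that copy, and that element is incomparable to `l` and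
to `u`, hence to the whole interval (`exists_incomp`). Prescribing an arbitrary value at an element
incomparable to the current domain violates nothing.

*Arguments.* To extend a finite partial map at `x`, the images `B` of the elements below `x` and `C`
of those above `x` must be interpolated by one element. If `B` or `C` is a chain, this follows from
directedness (and, in the strict case, from density, which comes from copies of `V` and `Λ`).
Otherwise incomparable elements of `B` and of `C` come from incomparable elements on both sides of
`x`; transporting `x` along a partial embedding interpolates any two pairs of incomparable elements,
and Riesz-style induction gives interpolation for all finite sets (`exists_between_of_good`).
-/

namespace PosetHomog

variable {P : Type*}

/-! ### Back-and-forth -/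

section BackAndForth

/-- A finite set of pairs, seen as a finite partial map, all of whose pairs (equal ones included)
satisfy the compatibility relation `R`. -/
def Compat (R : P × P → P × P → Prop) (S : Finset (P × P)) : Prop :=
  ∀ p ∈ S, ∀ q ∈ S, R p q

theorem Compat.insert [DecidableEq (P × P)] {R : P × P → P × P → Prop} {S : Finset (P × P)}
    (hS : Compat R S) {p : P × P} (hp : R p p) (h : ∀ q ∈ S, R p q ∧ R q p) :
    Compat R (insert p S) := by
  intro a ha b hb
  rw [Finset.mem_insert] at ha hb
  rcases ha with rfl | ha <;> rcases hb with rfl | hb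
  · exact hp
  · exact (h b hb).1
  · exact (h a ha).2
  · exact hS a ha b hb

/-- Back-and-forth over a countable set; a step back is only needed for a value not yet taken.
Functionality is asked of `R` in both directions at once, so that `R` may be a one-sided condition
such as `p.1 ≤ q.1 → p.2 ≤ q.2`. -/
theorem exists_surjective_of_back_and_forth [Countable P] [DecidableEq (P × P)] (R : P × P → P × P → Prop)
    (hR : ∀ p q, R p q → R q p → p.1 = q.1 → p.2 = q.2)
    (forth : ∀ S, Compat R S → ∀ x, ∃ y, Compat R (insert (x, y) S))
    (back : ∀ S, Compat R S → ∀ y, (∀ p ∈ S, p.2 ≠ y) → ∃ x, Compat R (insert (x, y) S))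
    (S : Finset (P × P)) (hS : Compat R S) :
    ∃ g : P → P, Function.Surjective g ∧ (∀ x y, R (x, g x) (y, g y)) ∧
      ∀ p ∈ S, g p.1 = p.2 := by
  classical
  have := Encodable.ofCountable P
  let Q := {S : Finset (P × P) // Compat R S}
  let D : P ⊕ P → Order.Cofinal Q := Sum.elim
    (fun x => ⟨{T | ∃ y, (x, y) ∈ T.1}, fun S => by
      obtain ⟨y, hT⟩ := forth S.1 S.2 x
      exact ⟨⟨_, hT⟩, ⟨y, Finset.mem_insert_self _ _⟩, Finset.subset_insert _ _⟩⟩)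
    (fun y => ⟨{T | ∃ x, (x, y) ∈ T.1}, fun S => by
      by_cases hy : ∃ p ∈ S.1, p.2 = y
      · obtain ⟨p, hp, rfl⟩ := hy
        exact ⟨S, ⟨p.1, hp⟩, le_rfl⟩
      · obtain ⟨x, hT⟩ := back S.1 S.2 y fun p hp h => hy ⟨p, hp, h⟩
        exact ⟨⟨_, hT⟩, ⟨x, Finset.mem_insert_self _ _⟩, Finset.subset_insert _ _⟩⟩)
  let I : Order.Ideal Q := Order.idealOfCofinals ⟨S, hS⟩ D
  have hI : ∀ {p q : P × P} {T U : Q}, T ∈ I → U ∈ I → p ∈ T.1 → q ∈ U.1 → R p q := by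
    intro p q T U hT hU hp hq
    obtain ⟨W, -, hTW, hUW⟩ := I.directed T hT U hU
    exact W.2 p (hTW hp) q (hUW hq)
  have hdom : ∀ x, ∃ y, ∃ T ∈ I, (x, y) ∈ T.1 := fun x => by
    obtain ⟨T, ⟨y, h⟩, hT⟩ := Order.cofinal_meets_idealOfCofinals ⟨S, hS⟩ D (Sum.inl x)
    exact ⟨y, T, hT, h⟩
  choose g T hT hg using hdom
  refine ⟨g, fun y => ?_, fun x y => hI (hT x) (hT y) (hg x) (hg y), fun p hp => ?_⟩
  · obtain ⟨U, ⟨x, h⟩, hU⟩ := Order.cofinal_meets_idealOfCofinals ⟨S, hS⟩ D (Sum.inr y)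
    exact ⟨x, hR _ _ (hI (hT x) hU (hg x) h) (hI hU (hT x) h (hg x)) rfl⟩
  · have hSI := Order.mem_idealOfCofinals (⟨S, hS⟩ : Q) D
    exact hR _ _ (hI (hT p.1) hSI (hg p.1) hp) (hI hSI (hT p.1) hp (hg p.1)) rfl

/-- The graph of a map on a finite subset. -/
def graph (A : Finset P) (f : A → P) : Finset (P × P) :=
  A.attach.map ⟨fun a => (a.1, f a), fun _ _ h => Subtype.ext (congrArg Prod.fst h)⟩

theorem mem_graph {A : Finset P} {f : A → P} {p : P × P} :
    p ∈ graph A f ↔ ∃ a : A, ((a : P), f a) = p := by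
  simp only [graph, Finset.mem_map, Finset.mem_attach, true_and]
  rfl

end BackAndForth

/-! ### Interpolation between finite sets -/

section Interpolation

variable {r : P → P → Prop}

/-! In this part the relation `r` stands for `≤`, `<` or the reverse of one of them. -/

theorem exists_upper (hdir : ∀ a b, ∃ c, r a c ∧ r b c) (htrans : ∀ a b c, r a b → r b c → r a c)
    [Nonempty P] (B : Finset P) : ∃ y, ∀ b ∈ B, r b y := by
  classical
  induction B using Finset.induction_on with
  | empty => simp
  | insert b B _ ih =>
    obtain ⟨y, hy⟩ := ih
    obtain ⟨z, hbz, hyz⟩ := hdir b y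
    refine ⟨z, fun c hc => ?_⟩
    rcases Finset.mem_insert.1 hc with rfl | hc
    · exact hbz
    · exact htrans _ _ _ (hy c hc) hyz

/-- Interpolation between two elements and a finite set reduces to two elements on each side. The
assumption concerns fixed `b₁` and `b₂`; with `b₁ = b₂` it covers a single lower element. -/
theorem exists_between_two (hdir : ∀ a b, ∃ c, r a c ∧ r b c)
    (htrans : ∀ a b c, r a b → r b c → r a c) (b₁ b₂ : P)
    (h : ∀ c₁ c₂, r b₁ c₁ → r b₁ c₂ → r b₂ c₁ → r b₂ c₂ →
      ∃ y, r b₁ y ∧ r b₂ y ∧ r y c₁ ∧ r y c₂)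
    (C : Finset P) (h₁ : ∀ c ∈ C, r b₁ c) (h₂ : ∀ c ∈ C, r b₂ c) :
    ∃ y, r b₁ y ∧ r b₂ y ∧ ∀ c ∈ C, r y c := by
  classical
  induction C using Finset.induction_on with
  | empty => simpa using hdir b₁ b₂
  | insert c C _ ih =>
    simp only [Finset.mem_insert, forall_eq_or_imp] at h₁ h₂
    obtain ⟨y, hy₁, hy₂, hy⟩ := ih h₁.2 h₂.2
    obtain ⟨z, hz₁, hz₂, hzc, hzy⟩ := h c y h₁.1 hy₁ h₂.1 hy₂
    refine ⟨z, hz₁, hz₂, fun d hd => ?_⟩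
    rcases Finset.mem_insert.1 hd with rfl | hd
    · exact hzc
    · exact htrans _ _ _ hzy (hy d hd)

theorem exists_between (hup : ∀ a b, ∃ c, r a c ∧ r b c) (hdown : ∀ a b, ∃ c, r c a ∧ r c b)
    (htrans : ∀ a b c, r a b → r b c → r a c) [Nonempty P]
    (h : ∀ b₁ b₂ c₁ c₂, r b₁ c₁ → r b₁ c₂ → r b₂ c₁ → r b₂ c₂ →
      ∃ y, r b₁ y ∧ r b₂ y ∧ r y c₁ ∧ r y c₂)
    (B C : Finset P) (hBC : ∀ b ∈ B, ∀ c ∈ C, r b c) :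
    ∃ y, (∀ b ∈ B, r b y) ∧ ∀ c ∈ C, r y c := by
  classical
  induction B using Finset.induction_on with
  | empty =>
    simpa [flip] using exists_upper (r := flip r) hdown (fun a b c hab hbc => htrans c b a hbc hab) C
  | insert b B _ ih =>
    simp only [Finset.mem_insert, forall_eq_or_imp] at hBC
    obtain ⟨y, hBy, hyC⟩ := ih hBC.2
    obtain ⟨z, hbz, hyz, hzC⟩ := exists_between_two hup htrans b y (h b y) C hBC.1 hyC
    refine ⟨z, fun d hd => ?_, hzC⟩
    rcases Finset.mem_insert.1 hd with rfl | hd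
    · exact hbz
    · exact htrans _ _ _ (hBy d hd) hyz

/-- If the lower set is a chain, interpolation only uses that a single element below two others can
be interpolated. -/
theorem exists_between_of_chain (hup : ∀ a b, ∃ c, r a c ∧ r b c)
    (hdown : ∀ a b, ∃ c, r c a ∧ r c b)
    (htrans : ∀ a b c, r a b → r b c → r a c) [Nonempty P]
    (h : ∀ b c₁ c₂, r b c₁ → r b c₂ → ∃ y, r b y ∧ r y c₁ ∧ r y c₂)
    (B C : Finset P) (hBC : ∀ b ∈ B, ∀ c ∈ C, r b c)
    (hB : ∀ a ∈ B, ∀ b ∈ B, (∀ c, r b c → r a c) ∨ (∀ c, r a c → r b c)) :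
    ∃ y, (∀ b ∈ B, r b y) ∧ ∀ c ∈ C, r y c := by
  classical
  -- some `b` satisfies `r b c` for `c ∈ C`, and everything `r`-above `b` is `r`-above all of `B`
  have key : ∃ b, (∀ c ∈ C, r b c) ∧ ∀ a ∈ B, ∀ c, r b c → r a c := by
    rcases B.eq_empty_or_nonempty with rfl | hne
    · obtain ⟨y, hy⟩ := exists_upper (r := flip r) hdown
        (fun a b c hab hbc => htrans c b a hbc hab) C
      exact ⟨y, hy, by simp⟩
    · suffices ∃ b ∈ B, ∀ a ∈ B, ∀ c, r b c → r a c by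
        obtain ⟨b, hb, hb'⟩ := this
        exact ⟨b, hBC b hb, hb'⟩
      clear hBC
      induction hne using Finset.Nonempty.cons_induction with
      | singleton a => exact ⟨a, by simp, by simp⟩
      | cons a s _ _ ih =>
        obtain ⟨b, hb, hb'⟩ := ih fun x hx y hy =>
          hB x (Finset.mem_cons_of_mem hx) y (Finset.mem_cons_of_mem hy)
        rcases hB a (Finset.mem_cons_self a s) b (Finset.mem_cons_of_mem hb) with hab | hba
        · refine ⟨b, Finset.mem_cons_of_mem hb, fun d hd => ?_⟩
          rcases Finset.mem_cons.1 hd with rfl | hd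
          · exact hab
          · exact hb' d hd
        · refine ⟨a, Finset.mem_cons_self a s, fun d hd c hc => ?_⟩
          rcases Finset.mem_cons.1 hd with rfl | hd
          · exact hc
          · exact hb' d hd c (hba c hc)
  obtain ⟨b, hbC, hb⟩ := key
  obtain ⟨y, hby, -, hyC⟩ := exists_between_two hup htrans b b
    (fun c₁ c₂ h₁ h₂ _ _ => by
      obtain ⟨y, hy, h⟩ := h b c₁ c₂ h₁ h₂
      exact ⟨y, hy, hy, h⟩) C hbC hbC
  exact ⟨y, fun a ha => hb a ha y hby, hyC⟩

variable [PartialOrder P]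

/-- Some element of `P` lies above two incomparable elements and below two incomparable elements. -/
def HasCross (P : Type*) [PartialOrder P] : Prop :=
  ∃ a₁ a₂ x c₁ c₂ : P, IncompRel (· ≤ ·) a₁ a₂ ∧ IncompRel (· ≤ ·) c₁ c₂ ∧
    a₁ < x ∧ a₂ < x ∧ x < c₁ ∧ x < c₂

/-- The pairs of finite sets between which an element is always found: one of the two is a chain,
or `P` has an element with branching on both sides. -/
def Good (B C : Finset P) : Prop :=
  (∀ a ∈ B, ∀ b ∈ B, a ≤ b ∨ b ≤ a) ∨ (∀ a ∈ C, ∀ b ∈ C, a ≤ b ∨ b ≤ a) ∨ HasCross P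

theorem Good.insert_right [DecidableEq P] {B C : Finset P} (h : Good B C) {y : P}
    (hy : ∀ c ∈ C, y < c) : Good B (insert y C) := by
  rcases h with h | h | h
  · exact Or.inl h
  · refine Or.inr (Or.inl fun a ha b hb => ?_)
    rw [Finset.mem_insert] at ha hb
    rcases ha with rfl | ha <;> rcases hb with rfl | hb
    · exact Or.inl le_rfl
    · exact Or.inl (hy _ hb).le
    · exact Or.inr (hy _ ha).le
    · exact h a ha b hb
  · exact Or.inr (Or.inr h)

/-- The images of the elements below and above an element `x` always form a good pair: otherwise
`x` itself would branch on both sides. -/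
theorem good_of_le {S : Finset (P × P)} (hS : ∀ p ∈ S, ∀ q ∈ S, p.1 ≤ q.1 → p.2 ≤ q.2)
    {B C : Finset P} {x : P} (hB : ∀ b ∈ B, ∃ a, a ≤ x ∧ (a, b) ∈ S)
    (hC : ∀ c ∈ C, ∃ a, x ≤ a ∧ (a, c) ∈ S) : Good B C := by
  by_contra h
  simp only [Good, not_or] at h
  obtain ⟨h₁, h₂, h₃⟩ := h
  push Not at h₁ h₂
  obtain ⟨b₁, hb₁, b₂, hb₂, hb, hb'⟩ := h₁
  obtain ⟨c₁, hc₁, c₂, hc₂, hc, hc'⟩ := h₂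
  obtain ⟨a₁, ha₁, h₁⟩ := hB b₁ hb₁
  obtain ⟨a₂, ha₂, h₂⟩ := hB b₂ hb₂
  obtain ⟨d₁, hd₁, k₁⟩ := hC c₁ hc₁
  obtain ⟨d₂, hd₂, k₂⟩ := hC c₂ hc₂
  have ha : ¬ a₁ ≤ a₂ := fun h => hb (hS _ h₁ _ h₂ h)
  have ha' : ¬ a₂ ≤ a₁ := fun h => hb' (hS _ h₂ _ h₁ h)
  have hd : ¬ d₁ ≤ d₂ := fun h => hc (hS _ k₁ _ k₂ h)
  have hd' : ¬ d₂ ≤ d₁ := fun h => hc' (hS _ k₂ _ k₁ h)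
  exact h₃ ⟨a₁, a₂, x, d₁, d₂, ⟨ha, ha'⟩, ⟨hd, hd'⟩,
    ha₁.lt_of_ne fun h => ha' (h ▸ ha₂), ha₂.lt_of_ne fun h => ha (h ▸ ha₁),
    hd₁.lt_of_ne fun h => hd (h ▸ hd₂), hd₂.lt_of_ne fun h => hd' (h ▸ hd₁)⟩

/-- Finite interpolation from interpolation of one or two elements on each side, with two
incomparable pairs needed only if `P` has a cross. -/
theorem exists_between_of_good [Nonempty P] (hup : ∀ a b, ∃ c, r a c ∧ r b c)
    (hdown : ∀ a b, ∃ c, r c a ∧ r c b) (htrans : ∀ a b c, r a b → r b c → r a c)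
    (hl : ∀ a b c, a ≤ b → r b c → r a c) (hr : ∀ a b c, r a b → b ≤ c → r a c)
    (h₁₂ : ∀ b c₁ c₂, r b c₁ → r b c₂ → ∃ y, r b y ∧ r y c₁ ∧ r y c₂)
    (h₂₁ : ∀ c b₁ b₂, r b₁ c → r b₂ c → ∃ y, r y c ∧ r b₁ y ∧ r b₂ y)
    (h₂₂ : HasCross P → ∀ b₁ b₂ c₁ c₂, IncompRel (· ≤ ·) b₁ b₂ → IncompRel (· ≤ ·) c₁ c₂ →
      r b₁ c₁ → r b₁ c₂ → r b₂ c₁ → r b₂ c₂ → ∃ y, r b₁ y ∧ r b₂ y ∧ r y c₁ ∧ r y c₂)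
    {B C : Finset P} (hg : Good B C) (hBC : ∀ b ∈ B, ∀ c ∈ C, r b c) :
    ∃ y, (∀ b ∈ B, r b y) ∧ ∀ c ∈ C, r y c := by
  rcases hg with h | h | h
  · exact exists_between_of_chain hup hdown htrans h₁₂ B C hBC fun a ha b hb =>
      (h a ha b hb).imp (fun h c => hl a b c h) (fun h c => hl b a c h)
  · obtain ⟨y, hC, hB⟩ := exists_between_of_chain (r := flip r) hdown hup
      (fun a b c hab hbc => htrans c b a hbc hab) h₂₁ C B (fun c hc b hb => hBC b hb c hc)
      fun a ha b hb => (h b hb a ha).imp (fun h c hc => hr c b a hc h)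
        (fun h c hc => hr c a b hc h)
    exact ⟨y, hB, hC⟩
  · refine exists_between hup hdown htrans (fun b₁ b₂ c₁ c₂ h11 h12 h21 h22 => ?_) B C hBC
    by_cases hb : b₁ ≤ b₂
    · obtain ⟨y, h₁, h₂, h₃⟩ := h₁₂ b₂ c₁ c₂ h21 h22
      exact ⟨y, hl _ _ _ hb h₁, h₁, h₂, h₃⟩
    by_cases hb' : b₂ ≤ b₁
    · obtain ⟨y, h₁, h₂, h₃⟩ := h₁₂ b₁ c₁ c₂ h11 h12
      exact ⟨y, h₁, hl _ _ _ hb' h₁, h₂, h₃⟩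
    by_cases hc : c₁ ≤ c₂
    · obtain ⟨y, h₁, h₂, h₃⟩ := h₂₁ c₁ b₁ b₂ h11 h21
      exact ⟨y, h₂, h₃, h₁, hr _ _ _ h₁ hc⟩
    by_cases hc' : c₂ ≤ c₁
    · obtain ⟨y, h₁, h₂, h₃⟩ := h₂₁ c₂ b₁ b₂ h12 h22
      exact ⟨y, h₂, h₃, hr _ _ _ h₁ hc', h₁⟩
    exact h₂₂ h _ _ _ _ ⟨hb, hb'⟩ ⟨hc, hc'⟩ h11 h12 h21 h22

end Interpolation

/-! ### Directedness and incomparable elements -/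

section Order

variable [PartialOrder P]

/-- Partial embeddings given by two finite families with the same order pattern. -/
theorem ExtendsTo.exists_of_le_iff {Y : (P → P) → Prop}
    (h : ExtendsTo P (fun _ f => IsEmb f) Y) {n : ℕ} (u v : Fin n → P)
    (huv : ∀ i j, u i ≤ u j ↔ v i ≤ v j) : ∃ g : P → P, Y g ∧ ∀ i, g (u i) = v i := by
  classical
  have hinj : ∀ i j, u i = u j ↔ v i = v j := fun i j => by
    rw [le_antisymm_iff, le_antisymm_iff, huv, huv]
  have hA : ∀ a : (Finset.univ.image u : Finset P), ∃ i, u i = a := fun a => by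
    obtain ⟨i, -, hi⟩ := Finset.mem_image.1 a.2
    exact ⟨i, hi⟩
  choose k hk using hA
  obtain ⟨g, hg, hgf⟩ := h (Finset.univ.image u) (fun a => v (k a)) ⟨fun a b hab => by
    have := (hinj _ _).2 hab
    rw [hk, hk] at this
    exact Subtype.ext this, fun a b => by
    rw [lt_iff_le_not_ge, lt_iff_le_not_ge, ← huv, ← huv, hk, hk]
    rfl⟩
  refine ⟨g, hg, fun i => ?_⟩
  rw [hgf ⟨u i, by simp⟩]
  exact (hinj _ _).1 (hk ⟨u i, by simp⟩)

/-- The outer elements of a cross can be sent to any two incomparable elements below two others. -/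
theorem ExtendsTo.exists_of_cross {Y : (P → P) → Prop}
    (h : ExtendsTo P (fun _ f => IsEmb f) Y) {a₁ a₂ x d₁ d₂ b₁ b₂ c₁ c₂ : P}
    (ha : IncompRel (· ≤ ·) a₁ a₂) (hd : IncompRel (· ≤ ·) d₁ d₂)
    (ha₁ : a₁ < x) (ha₂ : a₂ < x) (hd₁ : x < d₁) (hd₂ : x < d₂)
    (hb : IncompRel (· ≤ ·) b₁ b₂) (hc : IncompRel (· ≤ ·) c₁ c₂)
    (k11 : b₁ < c₁) (k12 : b₁ < c₂) (k21 : b₂ < c₁) (k22 : b₂ < c₂) :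
    ∃ g : P → P, Y g ∧ g a₁ = b₁ ∧ g a₂ = b₂ ∧ g d₁ = c₁ ∧ g d₂ = c₂ := by
  have e11 := ha₁.trans hd₁
  have e12 := ha₁.trans hd₂
  have e21 := ha₂.trans hd₁
  have e22 := ha₂.trans hd₂
  obtain ⟨g, hg, hgv⟩ := h.exists_of_le_iff ![a₁, a₂, d₁, d₂] ![b₁, b₂, c₁, c₂] (by
    simp [Fin.forall_fin_succ, ha.1, ha.2, hd.1, hd.2, hb.1, hb.2, hc.1, hc.2, k11.le, k12.le,
      k21.le, k22.le, k11.not_ge, k12.not_ge, k21.not_ge, k22.not_ge, e11.le, e12.le, e21.le,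
      e22.le, e11.not_ge, e12.not_ge, e21.not_ge, e22.not_ge])
  exact ⟨g, hg, by simpa [Fin.forall_fin_succ] using hgv⟩

theorem IsIEbar.isIHbar (h : IsIEbar P) : IsIHbar P := fun A f hf => by
  obtain ⟨g, hg, hgf⟩ := h A f hf
  exact ⟨g, hg.1, hgf⟩

theorem exists_of_posetV (h : Nonempty (PosetV ↪o P)) :
    ∃ a b c : P, a < b ∧ a < c ∧ IncompRel (· ≤ ·) b c := by
  obtain ⟨e⟩ := h
  refine ⟨e ⊥, e ((Sum.inl () : Unit ⊕ Unit) : PosetV), e ((Sum.inr () : Unit ⊕ Unit) : PosetV),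
    e.lt_iff_lt.2 (WithBot.bot_lt_coe _), e.lt_iff_lt.2 (WithBot.bot_lt_coe _), ?_, ?_⟩ <;>
  simp [e.le_iff_le]

theorem exists_of_posetLambda (h : Nonempty (PosetLambda ↪o P)) :
    ∃ a b c : P, b < a ∧ c < a ∧ IncompRel (· ≤ ·) b c := by
  obtain ⟨e⟩ := h
  refine ⟨e ⊤, e ((Sum.inl () : Unit ⊕ Unit) : PosetLambda),
    e ((Sum.inr () : Unit ⊕ Unit) : PosetLambda),
    e.lt_iff_lt.2 (WithTop.coe_lt_top _), e.lt_iff_lt.2 (WithTop.coe_lt_top _), ?_, ?_⟩ <;>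
  simp [e.le_iff_le]

theorem exists_of_posetZ (h : Nonempty (PosetZ ↪o P)) :
    ∃ a b c : P, a < b ∧ IncompRel (· ≤ ·) c a ∧ IncompRel (· ≤ ·) c b := by
  obtain ⟨e⟩ := h
  refine ⟨e (Sum.inl 0), e (Sum.inl 1), e (Sum.inr ()),
    e.lt_iff_lt.2 (Sum.inl_lt_inl_iff.2 (by decide)), ⟨?_, ?_⟩, ⟨?_, ?_⟩⟩ <;>
  simp [e.le_iff_le]

/-- A lower bound of two incomparable elements is the image of the bottom of a copy of `V`. -/
theorem exists_le_le (hV : Nonempty (PosetV ↪o P)) (h : IsIHbar P) (x y : P) :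
    ∃ z, z ≤ x ∧ z ≤ y := by
  obtain ⟨a, b, c, hab, hac, hbc⟩ := exists_of_posetV hV
  by_cases hxy : x ≤ y
  · exact ⟨x, le_rfl, hxy⟩
  by_cases hyx : y ≤ x
  · exact ⟨y, hyx, le_rfl⟩
  obtain ⟨g, hg, hgv⟩ := h.exists_of_le_iff ![b, c] ![x, y]
    (by simp [Fin.forall_fin_two, hxy, hyx, hbc.1, hbc.2])
  simp only [Fin.forall_fin_two, Matrix.cons_val_zero, Matrix.cons_val_one] at hgv
  exact ⟨g a, hgv.1 ▸ hg _ _ hab.le, hgv.2 ▸ hg _ _ hac.le⟩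

theorem exists_ge_ge (hL : Nonempty (PosetLambda ↪o P)) (h : IsIHbar P) (x y : P) :
    ∃ z, x ≤ z ∧ y ≤ z := by
  obtain ⟨a, b, c, hab, hac, hbc⟩ := exists_of_posetLambda hL
  by_cases hxy : x ≤ y
  · exact ⟨y, hxy, le_rfl⟩
  by_cases hyx : y ≤ x
  · exact ⟨x, le_rfl, hyx⟩
  obtain ⟨g, hg, hgv⟩ := h.exists_of_le_iff ![b, c] ![x, y]
    (by simp [Fin.forall_fin_two, hxy, hyx, hbc.1, hbc.2])
  simp only [Fin.forall_fin_two, Matrix.cons_val_zero, Matrix.cons_val_one] at hgv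
  exact ⟨g a, hgv.1 ▸ hg _ _ hab.le, hgv.2 ▸ hg _ _ hac.le⟩

/-- Every finite set admits an element incomparable to all of its elements: one incomparable to
both ends `l < u` of an interval containing the set, found as a preimage of the isolated point of
a copy of `Z`. -/
theorem exists_incomp (hV : Nonempty (PosetV ↪o P)) (hL : Nonempty (PosetLambda ↪o P))
    (hZ : Nonempty (PosetZ ↪o P)) (h : IsIEbar P) (A : Finset P) :
    ∃ x, ∀ a ∈ A, IncompRel (· ≤ ·) x a := by
  classical
  obtain ⟨p, q, z, hpq, hzp, hzq⟩ := exists_of_posetZ hZ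
  have : Nonempty P := ⟨p⟩
  -- adjoining `p` and `q` to the set makes its bounds distinct
  obtain ⟨u, hu⟩ := exists_upper (r := (· ≤ ·)) (exists_ge_ge hL h.isIHbar)
    (fun _ _ _ => le_trans) (insert p (insert q A))
  obtain ⟨l, hl⟩ := exists_upper (r := (· ≥ ·)) (exists_le_le hV h.isIHbar)
    (fun _ _ _ => ge_trans) (insert p (insert q A))
  simp only [Finset.mem_insert, forall_eq_or_imp] at hu hl
  have hlu : l < u := hl.1.trans_lt (hpq.trans_le hu.2.1)
  obtain ⟨g, ⟨hg, hs⟩, hgv⟩ := h.exists_of_le_iff ![l, u] ![p, q]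
    (by simp [Fin.forall_fin_two, hlu.le, hlu.not_ge, hpq.le, hpq.not_ge])
  simp only [Fin.forall_fin_two, Matrix.cons_val_zero, Matrix.cons_val_one] at hgv
  obtain ⟨x, rfl⟩ := hs z
  refine ⟨x, fun a ha => ⟨fun hxa => hzq.1 ?_, fun hax => hzp.2 ?_⟩⟩
  · exact hgv.2 ▸ hg _ _ (hxa.trans (hu.2.2 a ha))
  · exact hgv.1 ▸ hg _ _ ((hl.2.2 a ha).trans hax)

/-! ### Nonstrict homomorphisms -/

theorem IsIHbar.exists_between (hV : Nonempty (PosetV ↪o P)) (hL : Nonempty (PosetLambda ↪o P))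
    (h : IsIHbar P) {B C : Finset P} (hg : Good B C) (hBC : ∀ b ∈ B, ∀ c ∈ C, b ≤ c) :
    ∃ y, (∀ b ∈ B, b ≤ y) ∧ ∀ c ∈ C, y ≤ c := by
  have : Nonempty P := hV.map fun e => e ⊥
  refine exists_between_of_good (r := (· ≤ ·)) (exists_ge_ge hL h) (exists_le_le hV h)
    (fun _ _ _ => le_trans) (fun _ _ _ => le_trans) (fun _ _ _ => le_trans)
    (fun b _ _ h₁ h₂ => ⟨b, le_rfl, h₁, h₂⟩) (fun c _ _ h₁ h₂ => ⟨c, le_rfl, h₁, h₂⟩) ?_ hg hBC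
  rintro ⟨a₁, a₂, x, d₁, d₂, ha, hd, ha₁, ha₂, hd₁, hd₂⟩ b₁ b₂ c₁ c₂ hb hc h11 h12 h21 h22
  have k11 : b₁ < c₁ := h11.lt_of_ne (by rintro rfl; exact hb.2 h21)
  have k12 : b₁ < c₂ := h12.lt_of_ne (by rintro rfl; exact hb.2 h22)
  have k21 : b₂ < c₁ := h21.lt_of_ne (by rintro rfl; exact hb.1 h11)
  have k22 : b₂ < c₂ := h22.lt_of_ne (by rintro rfl; exact hb.1 h12)
  obtain ⟨g, hg, rfl, rfl, rfl, rfl⟩ :=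
    ExtendsTo.exists_of_cross h ha hd ha₁ ha₂ hd₁ hd₂ hb hc k11 k12 k21 k22
  exact ⟨g x, hg _ _ ha₁.le, hg _ _ ha₂.le, hg _ _ hd₁.le, hg _ _ hd₂.le⟩

/-- Back-and-forth for a kind of map given by `R`. The step back always succeeds, since a new value
can be taken at an element incomparable to the current domain. -/
theorem IsIEbar.exists_surjective_extension [Countable P] [DecidableEq (P × P)]
    (hV : Nonempty (PosetV ↪o P)) (hL : Nonempty (PosetLambda ↪o P))
    (hZ : Nonempty (PosetZ ↪o P)) (h : IsIEbar P) (R : P × P → P × P → Prop)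
    (hR : ∀ p q, R p q → R q p → p.1 = q.1 → p.2 = q.2) (hrefl : ∀ p, R p p)
    (hinc : ∀ p q, IncompRel (· ≤ ·) p.1 q.1 → p.2 ≠ q.2 → R p q)
    (forth : ∀ S, Compat R S → ∀ x, ∃ y, Compat R (insert (x, y) S))
    {A : Finset P} {f : A → P} (hf : ∀ a b : A, R (a, f a) (b, f b)) :
    ∃ g : P → P, Function.Surjective g ∧ (∀ x y, R (x, g x) (y, g y)) ∧ ∀ a : A, g a = f a := by
  classical
  obtain ⟨g, hs, hg, hgf⟩ := exists_surjective_of_back_and_forth R hR forth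
    (fun S hS y hy => by
      obtain ⟨x, hx⟩ := exists_incomp hV hL hZ h (S.image Prod.fst)
      refine ⟨x, hS.insert (hrefl _) fun q hq => ?_⟩
      have hxq := hx q.1 (Finset.mem_image_of_mem _ hq)
      exact ⟨hinc _ _ hxq (hy q hq).symm, hinc _ _ hxq.symm (hy q hq)⟩)
    (graph A f) (fun p hp q hq => by
      obtain ⟨a, rfl⟩ := mem_graph.1 hp
      obtain ⟨b, rfl⟩ := mem_graph.1 hq
      exact hf a b)
  exact ⟨g, hs, hg, fun a => hgf (a, f a) (mem_graph.2 ⟨a, rfl⟩)⟩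

theorem IsIEbar.isHbarEbar [Countable P] (hV : Nonempty (PosetV ↪o P))
    (hL : Nonempty (PosetLambda ↪o P)) (hZ : Nonempty (PosetZ ↪o P)) (h : IsIEbar P) :
    IsHbarEbar P := by
  classical
  intro A f hf
  obtain ⟨g, hs, hg, hgf⟩ := h.exists_surjective_extension hV hL hZ
    (fun p q : P × P => p.1 ≤ q.1 → p.2 ≤ q.2)
    (fun p q hpq hqp e => (hpq e.le).antisymm (hqp e.ge)) (fun _ _ => le_rfl)
    (fun p q hpq _ hle => absurd hle hpq.1)
    (fun S hS x => by
      obtain ⟨y, hy, hy'⟩ := h.isIHbar.exists_between hV hL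
        (B := (S.filter fun q => q.1 ≤ x).image Prod.snd)
        (C := (S.filter fun q => x ≤ q.1).image Prod.snd)
        (good_of_le (x := x) hS (fun b hb => by simpa [and_comm] using hb)
          (fun b hb => by simpa [and_comm] using hb))
        (fun b hb c hc => by
          simp only [Finset.mem_image, Finset.mem_filter] at hb hc
          obtain ⟨p, ⟨hp, hpx⟩, rfl⟩ := hb
          obtain ⟨q, ⟨hq, hxq⟩, rfl⟩ := hc
          exact hS p hp q hq (hpx.trans hxq))
      refine ⟨y, Compat.insert hS (fun _ => le_rfl) fun q hq => ⟨fun hle => hy' _ ?_,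
        fun hle => hy _ ?_⟩⟩ <;>
      exact Finset.mem_image_of_mem _ (Finset.mem_filter.2 ⟨hq, hle⟩))
    (f := f) (fun a b hab => hf a b hab)
  exact ⟨g, ⟨hg, hs⟩, hgf⟩

/-! ### Strict homomorphisms -/

theorem IsIEbar.exists_lt_lt (hV : Nonempty (PosetV ↪o P)) (hL : Nonempty (PosetLambda ↪o P))
    (hZ : Nonempty (PosetZ ↪o P)) (h : IsIEbar P) (a b : P) : ∃ c, c < a ∧ c < b := by
  obtain ⟨u, hau, hbu⟩ := exists_le_le hV h.isIHbar a b
  obtain ⟨x, hx⟩ := exists_incomp hV hL hZ h {u}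
  obtain ⟨w, huw, hxw⟩ := exists_le_le hV h.isIHbar u x
  have hxu := hx u (Finset.mem_singleton_self u)
  have : w < u := huw.lt_of_ne (by rintro rfl; exact hxu.2 hxw)
  exact ⟨w, this.trans_le hau, this.trans_le hbu⟩

theorem IsIEbar.exists_gt_gt (hV : Nonempty (PosetV ↪o P)) (hL : Nonempty (PosetLambda ↪o P))
    (hZ : Nonempty (PosetZ ↪o P)) (h : IsIEbar P) (a b : P) : ∃ c, a < c ∧ b < c := by
  obtain ⟨u, hau, hbu⟩ := exists_ge_ge hL h.isIHbar a b
  obtain ⟨x, hx⟩ := exists_incomp hV hL hZ h {u}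
  obtain ⟨w, huw, hxw⟩ := exists_ge_ge hL h.isIHbar u x
  have hxu := hx u (Finset.mem_singleton_self u)
  have : u < w := huw.lt_of_ne (by rintro rfl; exact hxu.1 hxw)
  exact ⟨w, hau.trans_lt this, hbu.trans_lt this⟩

/-- The element found is an image of the branching point `v` of a copy of `V`, which lies between
the two upper points and some `p < v`; omitting one upper point gives density. -/
theorem IsIH.exists_between_pair_of_le (hV : Nonempty (PosetV ↪o P))
    (hdown : ∀ a b : P, ∃ c, c < a ∧ c < b) (h : IsIH P) (b c₁ c₂ : P) (h₁ : b < c₁)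
    (h₂ : b < c₂) : ∃ y, b < y ∧ y < c₁ ∧ y < c₂ := by
  obtain ⟨v, c, d, hvc, hvd, hcd⟩ := exists_of_posetV hV
  obtain ⟨p, hpv, -⟩ := hdown v v
  have hpc := hpv.trans hvc
  have hpd := hpv.trans hvd
  have dense : ∀ {b c : P}, b < c → ∃ y, b < y ∧ y < c := fun {b e} hbe => by
    obtain ⟨g, hg, hgv⟩ := ExtendsTo.exists_of_le_iff h ![p, c] ![b, e]
      (by simp [Fin.forall_fin_two, hpc.le, hpc.not_ge, hbe.le, hbe.not_ge])
    simp [Fin.forall_fin_two] at hgv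
    obtain ⟨rfl, rfl⟩ := hgv
    exact ⟨g v, hg _ _ hpv, hg _ _ hvc⟩
  by_cases hc : c₁ ≤ c₂
  · obtain ⟨y, hy, hy'⟩ := dense h₁
    exact ⟨y, hy, hy', hy'.trans_le hc⟩
  by_cases hc' : c₂ ≤ c₁
  · obtain ⟨y, hy, hy'⟩ := dense h₂
    exact ⟨y, hy, hy'.trans_le hc', hy'⟩
  obtain ⟨g, hg, hgv⟩ := ExtendsTo.exists_of_le_iff h ![p, c, d] ![b, c₁, c₂]
    (by simp [Fin.forall_fin_succ, hpc.le, hpc.not_ge, hpd.le, hpd.not_ge, h₁.le, h₁.not_ge,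
      h₂.le, h₂.not_ge, hc, hc', hcd.1, hcd.2])
  simp [Fin.forall_fin_succ] at hgv
  obtain ⟨rfl, rfl, rfl⟩ := hgv
  exact ⟨g v, hg _ _ hpv, hg _ _ hvc, hg _ _ hvd⟩

theorem IsIH.exists_between_pair_of_ge (hL : Nonempty (PosetLambda ↪o P))
    (hup : ∀ a b : P, ∃ c, a < c ∧ b < c) (h : IsIH P) (b c₁ c₂ : P) (h₁ : c₁ < b)
    (h₂ : c₂ < b) : ∃ y, y < b ∧ c₁ < y ∧ c₂ < y := by
  obtain ⟨v, c, d, hvc, hvd, hcd⟩ := exists_of_posetLambda hL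
  obtain ⟨p, hpv, -⟩ := hup v v
  have hpc := hvc.trans hpv
  have hpd := hvd.trans hpv
  have dense : ∀ {b c : P}, c < b → ∃ y, y < b ∧ c < y := fun {b e} hbe => by
    obtain ⟨g, hg, hgv⟩ := ExtendsTo.exists_of_le_iff h ![p, c] ![b, e]
      (by simp [Fin.forall_fin_two, hpc.le, hpc.not_ge, hbe.le, hbe.not_ge])
    simp [Fin.forall_fin_two] at hgv
    obtain ⟨rfl, rfl⟩ := hgv
    exact ⟨g v, hg _ _ hpv, hg _ _ hvc⟩
  by_cases hc : c₁ ≤ c₂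
  · obtain ⟨y, hy, hy'⟩ := dense h₂
    exact ⟨y, hy, hc.trans_lt hy', hy'⟩
  by_cases hc' : c₂ ≤ c₁
  · obtain ⟨y, hy, hy'⟩ := dense h₁
    exact ⟨y, hy, hy', hc'.trans_lt hy'⟩
  obtain ⟨g, hg, hgv⟩ := ExtendsTo.exists_of_le_iff h ![p, c, d] ![b, c₁, c₂]
    (by simp [Fin.forall_fin_succ, hpc.le, hpc.not_ge, hpd.le, hpd.not_ge, h₁.le, h₁.not_ge,
      h₂.le, h₂.not_ge, hc, hc', hcd.1, hcd.2])
  simp [Fin.forall_fin_succ] at hgv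
  obtain ⟨rfl, rfl, rfl⟩ := hgv
  exact ⟨g v, hg _ _ hpv, hg _ _ hvc, hg _ _ hvd⟩

theorem IsIH.exists_between (hV : Nonempty (PosetV ↪o P)) (hL : Nonempty (PosetLambda ↪o P))
    (hdown : ∀ a b : P, ∃ c, c < a ∧ c < b) (hup : ∀ a b : P, ∃ c, a < c ∧ b < c) (h : IsIH P)
    {B C : Finset P} (hg : Good B C) (hBC : ∀ b ∈ B, ∀ c ∈ C, b < c) :
    ∃ y, (∀ b ∈ B, b < y) ∧ ∀ c ∈ C, y < c := by
  have : Nonempty P := hV.map fun e => e ⊥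
  refine exists_between_of_good (r := (· < ·)) hup hdown (fun _ _ _ => lt_trans)
    (fun _ _ _ => lt_of_le_of_lt) (fun _ _ _ => lt_of_lt_of_le)
    (h.exists_between_pair_of_le hV hdown) (h.exists_between_pair_of_ge hL hup) ?_ hg hBC
  rintro ⟨a₁, a₂, x, d₁, d₂, ha, hd, ha₁, ha₂, hd₁, hd₂⟩ b₁ b₂ c₁ c₂ hb hc k11 k12 k21 k22
  obtain ⟨g, hg, rfl, rfl, rfl, rfl⟩ :=
    ExtendsTo.exists_of_cross h ha hd ha₁ ha₂ hd₁ hd₂ hb hc k11 k12 k21 k22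
  exact ⟨g x, hg _ _ ha₁, hg _ _ ha₂, hg _ _ hd₁, hg _ _ hd₂⟩

/-- Interpolating elements can avoid any finite set, as is needed to keep maps injective. -/
theorem IsIH.exists_between_notMem (hV : Nonempty (PosetV ↪o P))
    (hL : Nonempty (PosetLambda ↪o P)) (hdown : ∀ a b : P, ∃ c, c < a ∧ c < b)
    (hup : ∀ a b : P, ∃ c, a < c ∧ b < c) (h : IsIH P) {B C : Finset P} (hg : Good B C)
    (hBC : ∀ b ∈ B, ∀ c ∈ C, b < c) (F : Finset P) :
    ∃ y ∉ F, (∀ b ∈ B, b < y) ∧ ∀ c ∈ C, y < c := by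
  classical
  -- below a minimal element of `F` between `B` and `C` there is another element between them
  let F' := F.filter fun y => (∀ b ∈ B, b < y) ∧ ∀ c ∈ C, y < c
  rcases F'.eq_empty_or_nonempty with hF | hF
  · obtain ⟨y, hy⟩ := h.exists_between hV hL hdown hup hg hBC
    exact ⟨y, fun hyF => Finset.notMem_empty y (hF ▸ Finset.mem_filter.2 ⟨hyF, hy⟩), hy⟩
  · obtain ⟨m, hm⟩ := F'.exists_minimal hF
    obtain ⟨-, hBm, hmC⟩ := Finset.mem_filter.1 hm.1
    obtain ⟨y, hBy, hyC⟩ := h.exists_between hV hL hdown hup (hg.insert_right hmC)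
      (fun b hb c hc => by
        rcases Finset.mem_insert.1 hc with rfl | hc
        · exact hBm b hb
        · exact hBC b hb c hc)
    simp only [Finset.mem_insert, forall_eq_or_imp] at hyC
    exact ⟨y, fun hyF => hm.not_lt (Finset.mem_filter.2 ⟨hyF, hBy, hyC.2⟩) hyC.1, hBy, hyC.2⟩

theorem IsIH.exists_extension_notMem (hV : Nonempty (PosetV ↪o P))
    (hL : Nonempty (PosetLambda ↪o P)) (hZ : Nonempty (PosetZ ↪o P)) (h' : IsIEbar P)
    (h : IsIH P) {S : Finset (P × P)}
    (hS : ∀ p ∈ S, ∀ q ∈ S, (p.1 = q.1 → p.2 = q.2) ∧ (p.1 < q.1 → p.2 < q.2)) (x : P)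
    (F : Finset P) : ∃ y ∉ F, ∀ q ∈ S, (q.1 < x → q.2 < y) ∧ (x < q.1 → y < q.2) := by
  classical
  obtain ⟨y, hyF, hy, hy'⟩ := h.exists_between_notMem hV hL (h'.exists_lt_lt hV hL hZ)
    (h'.exists_gt_gt hV hL hZ)
    (B := (S.filter fun q => q.1 < x).image Prod.snd)
    (C := (S.filter fun q => x < q.1).image Prod.snd)
    (good_of_le (x := x)
      (fun p hp q hq hpq => hpq.eq_or_lt.elim (fun e => ((hS p hp q hq).1 e).le)
        (fun l => ((hS p hp q hq).2 l).le))
      (fun b hb => by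
        obtain ⟨q, hq, rfl⟩ := Finset.mem_image.1 hb
        exact ⟨q.1, (Finset.mem_filter.1 hq).2.le, (Finset.mem_filter.1 hq).1⟩)
      (fun b hb => by
        obtain ⟨q, hq, rfl⟩ := Finset.mem_image.1 hb
        exact ⟨q.1, (Finset.mem_filter.1 hq).2.le, (Finset.mem_filter.1 hq).1⟩))
    (fun b hb c hc => by
      simp only [Finset.mem_image, Finset.mem_filter] at hb hc
      obtain ⟨p, ⟨hp, hpx⟩, rfl⟩ := hb
      obtain ⟨q, ⟨hq, hxq⟩, rfl⟩ := hc
      exact (hS p hp q hq).2 (hpx.trans hxq)) F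
  exact ⟨y, hyF, fun q hq =>
    ⟨fun hlt => hy _ (Finset.mem_image_of_mem _ (Finset.mem_filter.2 ⟨hq, hlt⟩)),
      fun hlt => hy' _ (Finset.mem_image_of_mem _ (Finset.mem_filter.2 ⟨hq, hlt⟩))⟩⟩

theorem IsIEbar.isHE [Countable P] (hV : Nonempty (PosetV ↪o P))
    (hL : Nonempty (PosetLambda ↪o P)) (hZ : Nonempty (PosetZ ↪o P)) (h' : IsIEbar P)
    (h : IsIH P) : IsHE P := by
  classical
  intro A f hf
  obtain ⟨g, hs, hg, hgf⟩ := h'.exists_surjective_extension hV hL hZ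
    (fun p q : P × P => (p.1 = q.1 → p.2 = q.2) ∧ (p.1 < q.1 → p.2 < q.2))
    (fun p q hpq _ => hpq.1) (fun p => ⟨fun _ => rfl, fun hlt => absurd hlt (lt_irrefl _)⟩)
    (fun p q hpq _ => ⟨fun e => absurd e.le hpq.1, fun hlt => absurd hlt.le hpq.1⟩)
    (fun S hS x => by
      by_cases hx : ∃ p ∈ S, p.1 = x
      · obtain ⟨p, hp, rfl⟩ := hx
        exact ⟨p.2, by rwa [Finset.insert_eq_of_mem hp]⟩
      obtain ⟨y, -, hy⟩ := h.exists_extension_notMem hV hL hZ h' hS x ∅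
      exact ⟨y, Compat.insert hS ⟨fun _ => rfl, fun hlt => absurd hlt (lt_irrefl _)⟩
        fun q hq => ⟨⟨fun e => absurd ⟨q, hq, e.symm⟩ hx, (hy q hq).2⟩,
          ⟨fun e => absurd ⟨q, hq, e⟩ hx, (hy q hq).1⟩⟩⟩)
    (f := f) (fun a b => ⟨fun e => congrArg f (Subtype.ext e), hf a b⟩)
  exact ⟨g, ⟨fun x y => (hg x y).2, hs⟩, hgf⟩

theorem IsIEbar.isMB [Countable P] (hV : Nonempty (PosetV ↪o P))
    (hL : Nonempty (PosetLambda ↪o P)) (hZ : Nonempty (PosetZ ↪o P)) (h' : IsIEbar P)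
    (h : IsIH P) : IsMB P := by
  classical
  intro A f hf
  obtain ⟨g, hs, hg, hgf⟩ := h'.exists_surjective_extension hV hL hZ
    (fun p q : P × P => (p.1 = q.1 ↔ p.2 = q.2) ∧ (p.1 < q.1 → p.2 < q.2))
    (fun p q hpq _ => hpq.1.1) (fun p => ⟨by simp, fun hlt => absurd hlt (lt_irrefl _)⟩)
    (fun p q hpq hne => ⟨iff_of_false (fun e => hpq.1 e.le) hne, fun hlt => absurd hlt.le hpq.1⟩)
    (fun S hS x => by
      by_cases hx : ∃ p ∈ S, p.1 = x
      · obtain ⟨p, hp, rfl⟩ := hx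
        exact ⟨p.2, by rwa [Finset.insert_eq_of_mem hp]⟩
      obtain ⟨y, hyS, hy⟩ := h.exists_extension_notMem hV hL hZ h'
        (fun p hp q hq => ⟨(hS p hp q hq).1.1, (hS p hp q hq).2⟩) x (S.image Prod.snd)
      have hne : ∀ q ∈ S, q.2 ≠ y := fun q hq e =>
        hyS (e ▸ Finset.mem_image_of_mem Prod.snd hq)
      exact ⟨y, Compat.insert hS ⟨by simp, fun hlt => absurd hlt (lt_irrefl _)⟩
        fun q hq =>
          ⟨⟨iff_of_false (fun e => hx ⟨q, hq, e.symm⟩) (hne q hq).symm, (hy q hq).2⟩,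
            ⟨iff_of_false (fun e => hx ⟨q, hq, e⟩) (hne q hq), (hy q hq).1⟩⟩⟩)
    (f := f) (fun a b => ⟨⟨fun e => congrArg f (Subtype.ext e),
      fun e => congrArg Subtype.val (hf.2 e)⟩, hf.1 a b⟩)
  exact ⟨g, ⟨⟨fun x y => (hg x y).2, fun x y e => (hg x y).1.2 e⟩, hs⟩, hgf⟩

end Order

end PosetHomog

theorem theorem2p13 (P : Type*) [PartialOrder P] [Countable P]
    (hV : Nonempty (PosetHomog.PosetV ↪o P))
    (hLambda : Nonempty (PosetHomog.PosetLambda ↪o P))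
    (hZ : Nonempty (PosetHomog.PosetZ ↪o P))
    (hIE : PosetHomog.IsIEbar P) :
    (PosetHomog.IsIHbar P → PosetHomog.IsHbarEbar P) ∧
      (PosetHomog.IsIH P → PosetHomog.IsHE P ∧ PosetHomog.IsMB P) := by
  exact ⟨fun _ => hIE.isHbarEbar hV hLambda hZ,
    fun hIH => ⟨hIE.isHE hV hLambda hZ hIH, hIE.isMB hV hLambda hZ hIH⟩⟩
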